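/- **Definitions.** A *tree order* is a partial order with a minimum element (the root) in which the set of elements below any given element is linearly ordered. A *branchwise-real tree* is a tree order in which every maximal chain is order-isomorphic to an interval of $\mathbb{R}$, and for any $x,y$ the set $\{z : z\le x,\ z\le y\}$ has a maximum. The *components above* $x$ are the classes of $\{y : y>x\}$ under the relation "there is $w>x$ with $w\le y$ and $w\le z$" between $y$ and $z$; the number of them is the *degree* of $x$. A tree order is *uniformly $\kappa$-branching* if every element has degree $\kappa$. For a cardinal $\kappa$, $\kappa-1$ denotes $\kappa$ if $\kappa$ is infinite, and $\max(\kappa-1,0)$ if $\kappa$ is finite. For a cardinal $\kappa$ and a cardinal $r\in\{\kappa,\kappa-1\}$ let $M_{\kappa,r}$ be the tree built in $\omega$ stages as follows. Start with a single root. At stage $1$ add $r$ open spines (pairwise incomparable copies of $(0,\infty)$) directly above the root. At stage $n+1$, for $n\ge 1$, add $\kappa-1$ open spines directly above every point that was added at stage $n$. Nothing else is added. The *minimal uniformly $\kappa$-branching branchwise-real tree* is $M_\kappa = M_{\kappa,\kappa}$; the tree $M_{\kappa,\kappa-1}$ is the variant in which $\kappa-1$ spines are added above the root too (the two agree for infinite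 $\kappa$). **Proposition.** Let $\kappa$ be a cardinal and $r\in\{\kappa,\kappa-1\}$. Then $M_{\kappa,r}$ is a branchwise-real tree, and $M_\kappa=M_{\kappa,\kappa}$ is uniformly $\kappa$-branching. Moreover: 1. (Minimality) For every uniformly $\kappa$-branching branchwise-real tree $X$ there is an order embedding $f\colon M_{\kappa,r}\to X$ (that is, $x\le y \Leftrightarrow f(x)\le f(y)$) which is continuous: for all $x<y$ in $M_{\kappa,r}$ the restriction $f{\upharpoonright}[x,y]\colon[x,y]\to[f(x),f(y)]$ is surjective. 2. (Homogeneity) If $x,y\in M_{\kappa,r}$ are not the root, there is an order-automorphism $f$ of $M_{\kappa,r}$ with $f(x)=y$. -/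

import Mathlib

universe u v

/-! ### Tree orders and branchwise-real trees -/

/-- A tree order: a partial order with a minimum element (the root) in which the set of
elements below any given element is linearly ordered. -/
class IsTreeOrder (X : Type u) [PartialOrder X] : Prop where
  isChain_Iic : ∀ x : X, IsChain (· ≤ ·) (Set.Iic x)
  exists_root : ∃ r : X, ∀ x : X, r ≤ x

/-- A branchwise-real tree: a tree order in which every branch (maximal chain) is
order-isomorphic to a real interval and any two elements have a meet. -/
class IsBranchwiseRealTree (X : Type u) [PartialOrder X] : Prop extends IsTreeOrder X where
  branch_real : ∀ B : Set X, IsMaxChain (· ≤ ·) B →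
    ∃ I : Set ℝ, I.OrdConnected ∧ Nonempty (B ≃o I)
  exists_meet : ∀ x y : X, ∃ m : X, IsGreatest {z : X | z ≤ x ∧ z ≤ y} m

/-- The relation `y ∼ₓ z` on the elements strictly above `x`: some `w > x` lies below both
`y` and `z`. Its equivalence classes are the connected components above `x`. -/
def componentSetoid {X : Type u} [PartialOrder X] [IsTreeOrder X] (x : X) :
    Setoid (Set.Ioi x) where
  r y z := ∃ w : X, x < w ∧ w ≤ y.1 ∧ w ≤ z.1
  iseqv :=
    { refl := fun y => ⟨y.1, y.2, le_rfl, le_rfl⟩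
      symm := fun ⟨w, h, hy, hz⟩ => ⟨w, h, hz, hy⟩
      trans := by
        rintro a b c ⟨w, hw, hwa, hwb⟩ ⟨w', hw', hwb', hwc⟩
        rcases (IsTreeOrder.isChain_Iic b.1).total hwb hwb' with h | h
        · exact ⟨w, hw, hwa, h.trans hwc⟩
        · exact ⟨w', hw', h.trans hwa, hwc⟩ }

/-- The degree of `x`: the number of connected components above `x`. -/
noncomputable def treeDegree {X : Type u} [PartialOrder X] [IsTreeOrder X] (x : X) :
    Cardinal.{u} :=
  Cardinal.mk (Quotient (componentSetoid x))

/-- A tree order is uniformly `κ`-branching if every element has degree `κ`. -/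
def IsUniformlyBranching (κ : Cardinal.{u}) (X : Type v) [PartialOrder X] [IsTreeOrder X] :
    Prop :=
  ∀ x : X, Cardinal.lift.{u} (treeDegree x) = Cardinal.lift.{v} κ

/-! ### Growing a tree in `ω` stages -/

/-- The elements other than the root of the tree grown in `ω` stages by adding at stage `1`
open spines (copies of `(0, ∞)`) indexed by `A` above the root, and at every later stage open
spines indexed by `B` above every element added at the previous stage. `first a t` is the
element at height `t` on the spine `a` above the root; `next p b t` is the element at height
`t` on the spine `b` above `p`. -/
inductive SpinePoint (A B : Type u) : Type u
  | first (a : A) (t : Set.Ioi (0 : ℝ)) : SpinePoint A B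
  | next (p : SpinePoint A B) (b : B) (t : Set.Ioi (0 : ℝ)) : SpinePoint A B

namespace SpinePoint

variable {A B : Type u}

/-- The stage at which an element was added. -/
def stage : SpinePoint A B → ℕ
  | first _ _ => 1
  | next p _ _ => p.stage + 1

/-- The order: the elements below a given one are those below it on its own spine, together
with the point above which that spine was added and the elements below that point. -/
def le (x : SpinePoint A B) : SpinePoint A B → Prop
  | first a t => ∃ s, s ≤ t ∧ x = first a s
  | next p b t => le x p ∨ ∃ s, s ≤ t ∧ x = next p b s

theorem le_rfl' (x : SpinePoint A B) : le x x := by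
  cases x with
  | first a t => exact ⟨t, le_rfl, rfl⟩
  | next p b t => exact Or.inr ⟨t, le_rfl, rfl⟩

theorem le_trans' {x y z : SpinePoint A B} (hxy : le x y) (hyz : le y z) : le x z := by
  induction z with
  | first a t =>
    obtain ⟨s, hs, rfl⟩ := hyz
    obtain ⟨s', hs', rfl⟩ := hxy
    exact ⟨s', hs'.trans hs, rfl⟩
  | next p b t ih =>
    rcases hyz with h | ⟨s, hs, rfl⟩
    · exact Or.inl (ih h)
    · rcases hxy with h | ⟨s', hs', rfl⟩
      · exact Or.inl h
      · exact Or.inr ⟨s', hs'.trans hs, rfl⟩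

theorem stage_le_of_le {x y : SpinePoint A B} (h : le x y) : x.stage ≤ y.stage := by
  induction y with
  | first a t => obtain ⟨s, _, rfl⟩ := h; exact le_rfl
  | next p b t ih =>
    rcases h with h | ⟨s, _, rfl⟩
    · exact (ih h).trans (Nat.le_succ _)
    · exact le_rfl

theorem le_antisymm' {x y : SpinePoint A B} (hxy : le x y) (hyx : le y x) : x = y := by
  cases y with
  | first a t =>
    obtain ⟨s, hs, rfl⟩ := hxy
    obtain ⟨s', hs', h⟩ := hyx
    obtain rfl : t = s' := by simpa using h
    rw [le_antisymm hs hs']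
  | next p b t =>
    rcases hxy with h | ⟨s, hs, rfl⟩
    · exact absurd (stage_le_of_le (le_trans' hyx h)) (Nat.not_succ_le_self _)
    · rcases hyx with h | ⟨s', hs', h⟩
      · exact absurd (stage_le_of_le h) (Nat.not_succ_le_self _)
      · obtain rfl : t = s' := by simpa using h
        rw [le_antisymm hs hs']

instance : PartialOrder (SpinePoint A B) where
  le := le
  le_refl := le_rfl'
  le_trans _ _ _ := le_trans'
  le_antisymm _ _ := le_antisymm'

theorem le_total_of_le {x y z : SpinePoint A B} (hx : x ≤ z) (hy : y ≤ z) :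
    x ≤ y ∨ y ≤ x := by
  induction z with
  | first a t =>
    obtain ⟨s, hs, rfl⟩ := hx
    obtain ⟨s', hs', rfl⟩ := hy
    rcases le_total s s' with h | h
    · exact Or.inl ⟨s, h, rfl⟩
    · exact Or.inr ⟨s', h, rfl⟩
  | next p b t ih =>
    rcases hx with hx | ⟨s, hs, rfl⟩
    · rcases hy with hy | ⟨s', hs', rfl⟩
      · exact ih hx hy
      · exact Or.inl (Or.inl hx)
    · rcases hy with hy | ⟨s', hs', rfl⟩
      · exact Or.inr (Or.inl hy)
      · rcases le_total s s' with h | h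
        · exact Or.inl (Or.inr ⟨s, h, rfl⟩)
        · exact Or.inr (Or.inr ⟨s', h, rfl⟩)

end SpinePoint

/-- The tree grown in `ω` stages, with root `⊥`. -/
abbrev SpineTree (A B : Type u) : Type u := WithBot (SpinePoint A B)

instance (A B : Type u) : IsTreeOrder (SpineTree A B) where
  exists_root := ⟨⊥, fun _ => bot_le⟩
  isChain_Iic := by
    intro z x hx y hy _
    induction x using WithBot.recBotCoe with
    | bot => exact Or.inl bot_le
    | coe x =>
      induction y using WithBot.recBotCoe with
      | bot => exact Or.inr bot_le
      | coe y =>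
        induction z using WithBot.recBotCoe with
        | bot => exact absurd hx (WithBot.not_coe_le_bot x)
        | coe z =>
          rcases SpinePoint.le_total_of_le (WithBot.coe_le_coe.1 hx) (WithBot.coe_le_coe.1 hy)
            with h | h
          · exact Or.inl (WithBot.coe_le_coe.2 h)
          · exact Or.inr (WithBot.coe_le_coe.2 h)

/-- `κ - 1`, meaning `n - 1` when `κ = n` is finite, and `κ` when `κ` is infinite. -/
noncomputable def cardPred (κ : Cardinal.{u}) : Cardinal.{u} :=
  open Classical in if κ < Cardinal.aleph0 then ((Cardinal.toNat κ - 1 : ℕ) : Cardinal.{u}) else κ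

/-- The minimal tree `M_κ` with `r` spines above the root: grown in `ω` stages from the root,
adding `r` open spines above the root and `κ - 1` open spines above every other element.
With `r = κ` every element has degree `κ`; with `r = κ - 1` the same number of spines is added
above every element, the root included. -/
abbrev MinimalTree (κ r : Cardinal.{u}) : Type u := SpineTree r.out (cardPred κ).out

/-! Directly above a point `p` there are the new spines and the continuation of the spine of `p`
itself (`rise p`). Order-theoretically `rise p` is just one more spine above `p`, and everything
strictly above `p` lies above a point of one of these spines. Hence `p` has degree (κ - 1) + 1 = κ
whenever points other than the root exist.

Branchwise-reality: total height above the root is strictly increasing and takes all intermediate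
values below a point, so it maps each branch isomorphically onto an interval. Meets are found by
induction on both points, descending to the base of a last spine.

Minimality: in a branchwise-real tree X an open spine can be found in each component above a given
point, since the elements below any point lie on a real interval. A copy of the tree is grown in X
stage by stage. The image of each point is stored with a reference point further along the same
spine (`growPair`). The reference point marks the component containing the continuation, and the κ -
1 new spines are put into other components. So distinct spines above a point go to distinct
components; comparing two points at their meet then shows that the order is reflected
(`le_of_map_le_of_isGreatest`). Continuity holds because no element of X between two image points is
skipped (`exists_grow_eq`).

Homogeneity: exchanging a new spine above `p` with the continuation of the spine of `p` is an
automorphism (`swapIso`), and it lowers the stage of the points on that new spine by one. Iterating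
brings any point to stage 1, where permuting the spines above the root and rescaling heights
suffices. -/

namespace SpinePoint

variable {A B : Type u}

/-! ### Spines and continuations above a point; heights -/

theorem first_le_first {a a' : A} {s t : Set.Ioi (0 : ℝ)} :
    (first a s : SpinePoint A B) ≤ first a' t ↔ a = a' ∧ s ≤ t := by
  constructor
  · rintro ⟨s', hs', h⟩
    obtain ⟨rfl, rfl⟩ := by simpa using h
    exact ⟨rfl, hs'⟩
  · rintro ⟨rfl, h⟩
    exact ⟨s, h, rfl⟩

theorem le_next_iff {x p : SpinePoint A B} {b : B} {t : Set.Ioi (0 : ℝ)} :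
    x ≤ next p b t ↔ x ≤ p ∨ ∃ s, s ≤ t ∧ x = next p b s := Iff.rfl

theorem stage_mono : Monotone (stage : SpinePoint A B → ℕ) := fun _ _ => stage_le_of_le

theorem lt_next (p : SpinePoint A B) (b : B) (t : Set.Ioi (0 : ℝ)) : p < next p b t := by
  refine lt_of_le_not_ge (Or.inl (le_rfl' p)) fun h => ?_
  exact absurd (stage_mono h) (Nat.not_succ_le_self _)

theorem next_le_next_left (p : SpinePoint A B) (b : B) {s t : Set.Ioi (0 : ℝ)} (h : s ≤ t) :
    next p b s ≤ next p b t := Or.inr ⟨s, h, rfl⟩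

/-- The element on the same spine as `p`, at the height of `p` on that spine increased by `t`. -/
def rise : SpinePoint A B → Set.Ioi (0 : ℝ) → SpinePoint A B
  | first a s, t => first a ⟨s.1 + t.1, Set.mem_Ioi.2 (add_pos (Set.mem_Ioi.1 s.2) (Set.mem_Ioi.1 t.2))⟩
  | next p b s, t => next p b ⟨s.1 + t.1, Set.mem_Ioi.2 (add_pos (Set.mem_Ioi.1 s.2) (Set.mem_Ioi.1 t.2))⟩

@[simp]
theorem stage_rise (p : SpinePoint A B) (t : Set.Ioi (0 : ℝ)) : (rise p t).stage = p.stage := by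
  cases p <;> rfl

/-- This has the same shape as `le_next_iff`, which is what lets the continuation of a spine be
treated as one more spine above `p` and be exchanged with a new one. -/
theorem le_rise_iff {x p : SpinePoint A B} {t : Set.Ioi (0 : ℝ)} :
    x ≤ rise p t ↔ x ≤ p ∨ ∃ s, s ≤ t ∧ x = rise p s := by
  have key : ∀ (a : Set.Ioi (0 : ℝ)) (F : Set.Ioi (0 : ℝ) → SpinePoint A B),
      (∃ s, s ≤ (⟨a.1 + t.1, Set.mem_Ioi.2 (add_pos (Set.mem_Ioi.1 a.2) (Set.mem_Ioi.1 t.2))⟩ : Set.Ioi (0 : ℝ)) ∧ x = F s) ↔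
      (∃ s, s ≤ a ∧ x = F s) ∨ ∃ s : Set.Ioi (0 : ℝ), s ≤ t ∧
        x = F ⟨a.1 + s.1, Set.mem_Ioi.2 (add_pos (Set.mem_Ioi.1 a.2) (Set.mem_Ioi.1 s.2))⟩ := by
    intro a F
    constructor
    · rintro ⟨s, hs, rfl⟩
      rcases le_or_gt s a with h | h
      · exact Or.inl ⟨s, h, rfl⟩
      · refine Or.inr ⟨⟨s.1 - a.1, Set.mem_Ioi.2 (sub_pos.2 (Subtype.coe_lt_coe.2 h))⟩, ?_, ?_⟩
        · have : s.1 ≤ a.1 + t.1 := hs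
          exact Subtype.coe_le_coe.1 (by simpa using by linarith)
        · congr 1
          ext
          simp
    · rintro (⟨s, hs, rfl⟩ | ⟨s, hs, rfl⟩)
      · exact ⟨s, hs.trans (Subtype.coe_le_coe.1 (by simpa using le_of_lt t.2)), rfl⟩
      · exact ⟨_, Subtype.coe_le_coe.1 (by simpa using hs), rfl⟩
  cases p with
  | first a s => exact key s (first a)
  | next q c s =>
    simp only [rise, le_next_iff, key s (next q c), or_assoc]

theorem rise_injective (p : SpinePoint A B) : Function.Injective (rise p) := by
  intro s t h
  cases p <;> simpa [rise, Subtype.ext_iff] using h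

theorem lt_rise (p : SpinePoint A B) (t : Set.Ioi (0 : ℝ)) : p < rise p t := by
  refine lt_of_le_of_ne (le_rise_iff.2 (Or.inl le_rfl)) fun h => ?_
  have ht : (0 : ℝ) < t.1 := t.2
  cases p <;> simp [rise, Subtype.ext_iff] at h <;> linarith

theorem rise_le_rise {p : SpinePoint A B} {s t : Set.Ioi (0 : ℝ)} (h : s ≤ t) :
    rise p s ≤ rise p t := le_rise_iff.2 (Or.inr ⟨s, h, rfl⟩)

/-- Every element above `p` lies above an element on the spine of `p` or on a spine added
above `p`. -/
theorem exists_rise_or_next_le {p x : SpinePoint A B} (h : p < x) :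
    ∃ t, rise p t ≤ x ∨ ∃ b, next p b t ≤ x := by
  induction x with
  | first a t =>
    obtain ⟨s, hs, rfl⟩ := h.le
    have hst : s < t := lt_of_le_of_ne hs (by rintro rfl; exact lt_irrefl _ h)
    refine ⟨⟨t.1 - s.1, Set.mem_Ioi.2 (sub_pos.2 (Subtype.coe_lt_coe.2 hst))⟩, Or.inl (le_of_eq ?_)⟩
    simp [rise]
  | next q b t ih =>
    rcases h.le with h' | ⟨s, hs, rfl⟩
    · rcases (show p ≤ q from h').eq_or_lt with rfl | h'
      · exact ⟨t, Or.inr ⟨b, le_rfl⟩⟩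
      · obtain ⟨s, hs⟩ := ih h'
        exact ⟨s, hs.imp (fun h => h.trans (lt_next _ _ _).le)
          fun ⟨b, h⟩ => ⟨b, h.trans (lt_next _ _ _).le⟩⟩
    · have hst : s < t := lt_of_le_of_ne hs (by rintro rfl; exact lt_irrefl _ h)
      refine ⟨⟨t.1 - s.1, Set.mem_Ioi.2 (sub_pos.2 (Subtype.coe_lt_coe.2 hst))⟩, Or.inl (le_of_eq ?_)⟩
      simp [rise]

theorem exists_first_le (x : SpinePoint A B) : ∃ a t, first a t ≤ x := by
  induction x with
  | first a t => exact ⟨a, t, le_rfl⟩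
  | next q b t ih =>
    obtain ⟨a, s, h⟩ := ih
    exact ⟨a, s, h.trans (lt_next _ _ _).le⟩

/-- A lower bound of two spines added above `p` that is above `p` determines the spine. -/
theorem eq_of_le_next_of_le_next {p z : SpinePoint A B} {b c : B} {s t : Set.Ioi (0 : ℝ)}
    (hz : p < z) (h₁ : z ≤ next p b s) (h₂ : z ≤ next p c t) : b = c := by
  rcases h₁ with h | ⟨s', -, rfl⟩
  · exact absurd h hz.not_ge
  rcases h₂ with h | ⟨t', -, h⟩
  · exact absurd h hz.not_ge
  · injection h

/-- The continuation keeps the stage of `p`, whereas a new spine has the next stage, so the two meet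
only at elements below `p`. -/
theorem not_le_next_of_le_rise {p z : SpinePoint A B} {b : B} {s t : Set.Ioi (0 : ℝ)}
    (hz : p < z) (h₁ : z ≤ rise p s) : ¬ z ≤ next p b t := by
  rcases le_rise_iff.1 h₁ with h | ⟨s', -, rfl⟩
  · exact absurd h hz.not_ge
  rintro (h | ⟨t', -, h⟩)
  · exact absurd h hz.not_ge
  · have := congrArg stage h
    simp [stage] at this

/-- The height of an element above the root. -/
noncomputable def height : SpinePoint A B → ℝ
  | first _ t => t
  | next p _ t => p.height + t

theorem height_pos (x : SpinePoint A B) : 0 < x.height := by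
  induction x with
  | first a t => exact t.2
  | next p b t ih => exact add_pos ih t.2

theorem height_mono : Monotone (height : SpinePoint A B → ℝ) := by
  intro x y h
  induction y with
  | first a t =>
    obtain ⟨s, hs, rfl⟩ := h
    exact hs
  | next p b t ih =>
    rcases h with h | ⟨s, hs, rfl⟩
    · exact (ih h).trans (le_add_of_nonneg_right (le_of_lt t.2))
    · exact add_le_add_right (show s.1 ≤ t.1 from hs) _

theorem height_rise (p : SpinePoint A B) (t : Set.Ioi (0 : ℝ)) :
    (rise p t).height = p.height + t := by
  cases p <;> simp [rise, height, add_assoc]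

theorem height_strictMono : StrictMono (height : SpinePoint A B → ℝ) := by
  intro x y h
  obtain ⟨t, h | ⟨b, h⟩⟩ := exists_rise_or_next_le h
  · refine lt_of_lt_of_le ?_ (height_mono h)
    rw [height_rise]
    exact lt_add_of_pos_right _ t.2
  · exact lt_of_lt_of_le (lt_add_of_pos_right _ t.2) (height_mono h)

theorem exists_le_height_eq (x : SpinePoint A B) {r : ℝ} (h₀ : 0 < r) (h : r ≤ x.height) :
    ∃ y ≤ x, y.height = r := by
  induction x with
  | first a t => exact ⟨first a ⟨r, h₀⟩, ⟨_, h, rfl⟩, rfl⟩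
  | next p b t ih =>
    rcases le_or_gt r p.height with h' | h'
    · obtain ⟨y, hy, e⟩ := ih h'
      exact ⟨y, hy.trans (lt_next _ _ _).le, e⟩
    · refine ⟨next p b ⟨r - p.height, Set.mem_Ioi.2 (sub_pos.2 h')⟩, next_le_next_left _ _ ?_, ?_⟩
      · exact Subtype.coe_le_coe.1 (by simp only [height] at h; simp; linarith)
      · simp [height]

end SpinePoint

/-! ### Branches and meets in the grown tree -/

namespace SpineTree

open SpinePoint

variable {A B : Type u}

/-- The height of an element above the root. -/
noncomputable def height : SpineTree A B → ℝ := fun x => x.recBotCoe 0 SpinePoint.height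

theorem height_strictMono : StrictMono (height : SpineTree A B → ℝ) := by
  intro x y h
  induction y using WithBot.recBotCoe with
  | bot => exact absurd h not_lt_bot
  | coe y =>
    induction x using WithBot.recBotCoe with
    | bot => exact y.height_pos
    | coe x => exact SpinePoint.height_strictMono (WithBot.coe_lt_coe.1 h)

theorem height_injOn_of_isChain {C : Set (SpineTree A B)} (hC : IsChain (· ≤ ·) C) :
    Set.InjOn height C := by
  intro x hx y hy h
  by_contra hne
  rcases hC hx hy hne with hxy | hyx
  · exact (height_strictMono (lt_of_le_of_ne hxy hne)).ne h
  · exact (height_strictMono (lt_of_le_of_ne hyx (Ne.symm hne))).ne h.symm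

theorem height_nonneg (x : SpineTree A B) : 0 ≤ height x :=
  height_strictMono.monotone (bot_le : ⊥ ≤ x)

theorem exists_le_height_eq (x : SpineTree A B) {r : ℝ} (h₀ : 0 ≤ r) (h : r ≤ height x) :
    ∃ y ≤ x, height y = r := by
  rcases h₀.eq_or_lt with rfl | h₀
  · exact ⟨⊥, bot_le, rfl⟩
  induction x using WithBot.recBotCoe with
  | bot => exact absurd h h₀.not_ge
  | coe x =>
    obtain ⟨y, hy, e⟩ := SpinePoint.exists_le_height_eq x h₀ h
    exact ⟨y, WithBot.coe_le_coe.2 hy, e⟩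

/-- Induction on both points. If no common lower bound lies on the last spine of one of them, that
point may be replaced by the base of its spine (`reduce`). For different last spines this always
applies to one side: a common bound on the last spine of `x` forces that spine to pass below the
base `p` of the last spine of `y`, and then no common bound lies on the last spine of `y`. -/
theorem exists_meet_coe (x y : SpinePoint A B) :
    ∃ m : SpineTree A B, IsGreatest {z : SpineTree A B | z ≤ x ∧ z ≤ y} m := by
  have comparable : ∀ x y : SpinePoint A B, x ≤ y →
      IsGreatest {z : SpineTree A B | z ≤ x ∧ z ≤ y} x :=
    fun x y h => ⟨⟨le_rfl, WithBot.coe_le_coe.2 h⟩, fun _ hz => hz.1⟩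
  have reduce : ∀ {x x' y : SpinePoint A B} {m : SpineTree A B}, x' ≤ x →
      IsGreatest {z : SpineTree A B | z ≤ x' ∧ z ≤ y} m →
      (∀ z, z ≤ x → z ≤ y → z ≤ x') →
      IsGreatest {z : SpineTree A B | z ≤ x ∧ z ≤ y} m := by
    intro x x' y m hx hm h
    refine ⟨⟨hm.1.1.trans (WithBot.coe_le_coe.2 hx), hm.1.2⟩, fun z hz => hm.2 ⟨?_, hz.2⟩⟩
    induction z using WithBot.recBotCoe with
    | bot => exact bot_le
    | coe z =>
      exact WithBot.coe_le_coe.2 (h z (WithBot.coe_le_coe.1 hz.1) (WithBot.coe_le_coe.1 hz.2))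
  have symm : ∀ {x y : SpinePoint A B},
      (∃ m : SpineTree A B, IsGreatest {z : SpineTree A B | z ≤ y ∧ z ≤ x} m) →
      ∃ m : SpineTree A B, IsGreatest {z : SpineTree A B | z ≤ x ∧ z ≤ y} m := by
    intro x y ⟨m, hm⟩
    exact ⟨m, by simpa only [and_comm] using hm⟩
  induction y generalizing x with
  | first a t =>
    induction x with
    | first a' s =>
      by_cases ha : a = a'
      · subst ha
        rcases le_total s t with h | h
        · exact ⟨_, comparable _ _ ⟨s, h, rfl⟩⟩
        · exact symm ⟨_, comparable _ _ ⟨t, h, rfl⟩⟩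
      · refine ⟨⊥, ⟨bot_le, bot_le⟩, fun z hz => ?_⟩
        induction z using WithBot.recBotCoe with
        | bot => exact le_rfl
        | coe z =>
          obtain ⟨s', -, rfl⟩ := WithBot.coe_le_coe.1 hz.1
          exact absurd (first_le_first.1 (WithBot.coe_le_coe.1 hz.2)).1.symm ha
    | next q c s ih =>
      obtain ⟨m, hm⟩ := ih
      refine ⟨m, reduce (lt_next _ _ _).le hm ?_⟩
      rintro z (h | ⟨s', -, rfl⟩) hz
      · exact h
      · obtain ⟨_, -, h⟩ := hz
        cases h
  | next p b t ihp =>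
    induction x with
    | first a s =>
      obtain ⟨m, hm⟩ := symm (ihp (first a s))
      refine symm ⟨m, reduce (lt_next _ _ _).le hm ?_⟩
      rintro z (h | ⟨s', -, rfl⟩) hz
      · exact h
      · obtain ⟨_, -, h⟩ := hz
        cases h
    | next q c s ihq =>
      by_cases hqc : q = p ∧ c = b
      · obtain ⟨rfl, rfl⟩ := hqc
        rcases le_total s t with h | h
        · exact ⟨_, comparable _ _ (next_le_next_left _ _ h)⟩
        · exact symm ⟨_, comparable _ _ (next_le_next_left _ _ h)⟩
      by_cases hall : ∀ z, z ≤ next q c s → z ≤ next p b t → z ≤ q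
      · obtain ⟨m, hm⟩ := ihq
        exact ⟨m, reduce (lt_next _ _ _).le hm hall⟩
      push Not at hall
      obtain ⟨z, hz, hz', hzq⟩ := hall
      obtain ⟨s', -, rfl⟩ := (le_next_iff.1 hz).resolve_left hzq
      have hp : next q c s' ≤ p := by
        refine (le_next_iff.1 hz').resolve_right ?_
        rintro ⟨_, -, h⟩
        injection h with h₁ h₂
        exact hqc ⟨h₁, h₂⟩
      obtain ⟨m, hm⟩ := symm (ihp (next q c s))
      refine symm ⟨m, reduce (lt_next _ _ _).le hm ?_⟩
      rintro z (h | ⟨t', -, rfl⟩) hz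
      · exact h
      · rcases hz with h | ⟨_, -, h⟩
        -- A common bound on the last spine of `y` lying below `q` would give p < q, against `hp`,
        -- by which `p` is above a point of the spine over `q`.
        · exact absurd ((lt_next p b t').trans_le h |>.trans (lt_next q c s')) hp.not_gt
        · injection h with h₁ h₂
          exact absurd ⟨h₁.symm, h₂.symm⟩ hqc

theorem exists_meet (x y : SpineTree A B) :
    ∃ m : SpineTree A B, IsGreatest {z : SpineTree A B | z ≤ x ∧ z ≤ y} m := by
  induction x using WithBot.recBotCoe with
  | bot => exact ⟨⊥, ⟨le_rfl, bot_le⟩, fun _ h => h.1⟩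
  | coe x =>
    induction y using WithBot.recBotCoe with
    | bot => exact ⟨⊥, ⟨bot_le, le_rfl⟩, fun _ h => h.2⟩
    | coe y => exact exists_meet_coe x y

/-- A maximal chain in a tree order is closed downwards. -/
theorem _root_.IsMaxChain.isLowerSet_of_isTreeOrder {X : Type u} [PartialOrder X] [IsTreeOrder X]
    {C : Set X} (hC : IsMaxChain (· ≤ ·) C) : IsLowerSet C := by
  intro y x hxy hy
  have h : IsChain (· ≤ ·) (insert x C) := hC.1.insert fun z hz _ => by
    rcases hC.1.total hy hz with h | h
    · exact Or.inl (hxy.trans h)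
    · exact (IsTreeOrder.isChain_Iic y).total hxy h
  rw [hC.2 h (Set.subset_insert _ _)]
  exact Set.mem_insert _ _

instance : IsBranchwiseRealTree (SpineTree A B) where
  exists_meet := exists_meet
  branch_real C hC := by
    refine ⟨height '' C, ⟨?_⟩, ⟨{
      toEquiv := ((height_injOn_of_isChain hC.1).bijOn_image).equiv _
      map_rel_iff' := ?_ }⟩⟩
    · rintro _ ⟨x, -, rfl⟩ _ ⟨y, hy, rfl⟩ r hr
      obtain ⟨z, hz, rfl⟩ := exists_le_height_eq y ((height_nonneg x).trans hr.1) hr.2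
      exact ⟨z, hC.isLowerSet_of_isTreeOrder hz hy, rfl⟩
    · rintro ⟨x, hx⟩ ⟨y, hy⟩
      refine ⟨fun h => ?_, fun h => height_strictMono.monotone h⟩
      rcases hC.1.total hx hy with hxy | hyx
      · exact hxy
      · rcases hyx.eq_or_lt with rfl | hyx
        · exact le_rfl
        · exact absurd h (height_strictMono hyx).not_ge

end SpineTree

/-! ### Degrees counted by families of spines -/

/-- A family of open spines directly above `x`, in pairwise different components. -/
structure IsSpineFamily {X : Type v} [PartialOrder X] {ι : Type u} (x : X)
    (e : ι → Set.Ioi (0 : ℝ) → X) : Prop where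
  strictMono : ∀ i, StrictMono (e i)
  lt : ∀ i t, x < e i t
  exists_eq : ∀ i t z, x < z → z ≤ e i t → ∃ s ≤ t, z = e i s
  eq_of_le : ∀ i j s t z, x < z → z ≤ e i s → z ≤ e j t → i = j

/-- A spine lies within a single component, so a spine determines a component; separation of the
spines gives injectivity and the covering hypothesis gives surjectivity. -/
theorem IsSpineFamily.mk_eq_treeDegree {X : Type u} [PartialOrder X] [IsTreeOrder X] {ι : Type u}
    {x : X} {e : ι → Set.Ioi (0 : ℝ) → X} (he : IsSpineFamily x e)
    (hcover : ∀ y, x < y → ∃ i t, e i t ≤ y) : Cardinal.mk ι = treeDegree x := by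
  refine Cardinal.mk_congr (Equiv.ofBijective
    (fun i => Quotient.mk (componentSetoid x) ⟨e i ⟨1, Set.mem_Ioi.2 one_pos⟩, he.lt i _⟩) ⟨?_, ?_⟩)
  · intro i j h
    obtain ⟨w, hw, hi, hj⟩ := Quotient.exact h
    exact he.eq_of_le i j _ _ w hw hi hj
  · intro c
    induction c using Quotient.inductionOn with
    | h y =>
      obtain ⟨i, t, h⟩ := hcover y.1 y.2
      exact ⟨i, Quotient.sound ⟨e i (min ⟨1, Set.mem_Ioi.2 one_pos⟩ t), he.lt i _,
        (he.strictMono i).monotone (min_le_left _ _),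
        ((he.strictMono i).monotone (min_le_right _ _)).trans h⟩⟩

namespace SpineTree

open SpinePoint

variable {A B : Type u}

/-- The spines added above the root. -/
def rootSpine (a : A) (t : Set.Ioi (0 : ℝ)) : SpineTree A B := (first a t : SpinePoint A B)

/-- The spines directly above `p`: those added above `p`, and the continuation of the spine
of `p`. -/
def pointSpine (p : SpinePoint A B) : Option B → Set.Ioi (0 : ℝ) → SpineTree A B
  | none, t => (rise p t : SpinePoint A B)
  | some b, t => (next p b t : SpinePoint A B)

theorem isSpineFamily_rootSpine : IsSpineFamily (⊥ : SpineTree A B) rootSpine where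
  strictMono a := Monotone.strictMono_of_injective
    (fun s t h => WithBot.coe_le_coe.2 ⟨s, h, rfl⟩)
    (fun s t h => by simpa [rootSpine] using h)
  lt a t := WithBot.bot_lt_coe _
  exists_eq a t z hz h := by
    induction z using WithBot.recBotCoe with
    | bot => exact absurd hz (lt_irrefl _)
    | coe z =>
      obtain ⟨s, hs, rfl⟩ := WithBot.coe_le_coe.1 h
      exact ⟨s, hs, rfl⟩
  eq_of_le a a' s t z hz h h' := by
    induction z using WithBot.recBotCoe with
    | bot => exact absurd hz (lt_irrefl _)
    | coe z =>
      obtain ⟨s, hs, rfl⟩ := WithBot.coe_le_coe.1 h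
      exact (first_le_first.1 (WithBot.coe_le_coe.1 h')).1

theorem exists_rootSpine_le {y : SpineTree A B} (h : ⊥ < y) : ∃ a t, rootSpine a t ≤ y := by
  induction y using WithBot.recBotCoe with
  | bot => exact absurd h (lt_irrefl _)
  | coe y =>
    obtain ⟨a, t, h⟩ := exists_first_le y
    exact ⟨a, t, WithBot.coe_le_coe.2 h⟩

theorem isSpineFamily_pointSpine (p : SpinePoint A B) :
    IsSpineFamily (p : SpineTree A B) (pointSpine p) where
  strictMono i := by
    cases i with
    | none =>
      exact Monotone.strictMono_of_injective
        (fun s t h => WithBot.coe_le_coe.2 (rise_le_rise h))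
        (fun s t h => rise_injective p (WithBot.coe_injective h))
    | some b =>
      exact Monotone.strictMono_of_injective
        (fun s t h => WithBot.coe_le_coe.2 (next_le_next_left p b h))
        (fun s t h => by simpa [pointSpine] using h)
  lt i t := by
    cases i with
    | none => exact WithBot.coe_lt_coe.2 (lt_rise p t)
    | some b => exact WithBot.coe_lt_coe.2 (lt_next p b t)
  exists_eq i t z hz h := by
    induction z using WithBot.recBotCoe with
    | bot => exact absurd hz not_lt_bot
    | coe z =>
      have hz := (WithBot.coe_lt_coe.1 hz).not_ge
      cases i with
      | none =>
        obtain ⟨s, hs, rfl⟩ := (le_rise_iff.1 (WithBot.coe_le_coe.1 h)).resolve_left hz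
        exact ⟨s, hs, rfl⟩
      | some b =>
        obtain ⟨s, hs, rfl⟩ := (le_next_iff.1 (WithBot.coe_le_coe.1 h)).resolve_left hz
        exact ⟨s, hs, rfl⟩
  eq_of_le i j s t z hz h h' := by
    induction z using WithBot.recBotCoe with
    | bot => exact absurd hz not_lt_bot
    | coe z =>
      have hz := WithBot.coe_lt_coe.1 hz
      cases i with
      | none =>
        cases j with
        | none => rfl
        | some c =>
          exact absurd (WithBot.coe_le_coe.1 h')
            (not_le_next_of_le_rise hz (WithBot.coe_le_coe.1 h))
      | some b =>
        cases j with
        | none =>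
          exact absurd (WithBot.coe_le_coe.1 h)
            (not_le_next_of_le_rise hz (WithBot.coe_le_coe.1 h'))
        | some c =>
          exact congrArg some (eq_of_le_next_of_le_next hz
            (WithBot.coe_le_coe.1 h) (WithBot.coe_le_coe.1 h'))

theorem exists_pointSpine_le {p : SpinePoint A B} {y : SpineTree A B}
    (h : (p : SpineTree A B) < y) : ∃ i t, pointSpine p i t ≤ y := by
  induction y using WithBot.recBotCoe with
  | bot => exact absurd h not_lt_bot
  | coe y =>
    obtain ⟨t, h | ⟨b, h⟩⟩ := exists_rise_or_next_le (WithBot.coe_lt_coe.1 h)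
    · exact ⟨none, t, WithBot.coe_le_coe.2 h⟩
    · exact ⟨some b, t, WithBot.coe_le_coe.2 h⟩

theorem treeDegree_bot : treeDegree (⊥ : SpineTree A B) = Cardinal.mk A :=
  (isSpineFamily_rootSpine.mk_eq_treeDegree fun _ => exists_rootSpine_le).symm

theorem treeDegree_coe (p : SpinePoint A B) :
    treeDegree (p : SpineTree A B) = Cardinal.mk B + 1 := by
  rw [← (isSpineFamily_pointSpine p).mk_eq_treeDegree fun _ => exists_pointSpine_le,
    Cardinal.mk_option]

end SpineTree

/-! ### The cardinal κ - 1 and uniform branching -/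

theorem cardPred_le (κ : Cardinal.{u}) : cardPred κ ≤ κ := by
  unfold cardPred
  split_ifs with h
  · obtain ⟨n, rfl⟩ := Cardinal.lt_aleph0.1 h
    simp only [Cardinal.toNat_natCast]
    exact_mod_cast Nat.sub_le n 1
  · exact le_rfl

theorem cardPred_add_one {κ : Cardinal.{u}} (hκ : κ ≠ 0) : cardPred κ + 1 = κ := by
  unfold cardPred
  split_ifs with h
  · obtain ⟨n, rfl⟩ := Cardinal.lt_aleph0.1 h
    simp only [Cardinal.toNat_natCast]
    have : n ≠ 0 := by exact_mod_cast hκ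
    exact_mod_cast Nat.sub_add_cancel (Nat.pos_of_ne_zero this)
  · exact Cardinal.add_one_eq (not_lt.1 h)

theorem lift_cardPred_le {κ : Cardinal.{u}} {s : Cardinal.{v}}
    (h : Cardinal.lift.{v} κ = Cardinal.lift.{u} s + 1) :
    Cardinal.lift.{v} (cardPred κ) ≤ Cardinal.lift.{u} s := by
  have hκ : κ ≠ 0 := by
    rintro rfl
    rw [Cardinal.lift_zero] at h
    exact one_ne_zero (add_eq_zero.1 h.symm).2
  rw [← cardPred_add_one hκ, Cardinal.lift_add, Cardinal.lift_one] at h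
  exact (Cardinal.add_one_inj.1 h).le

theorem isUniformlyBranching_minimalTree (κ : Cardinal.{u}) :
    IsUniformlyBranching κ (MinimalTree κ κ) := by
  intro x
  congr 1
  induction x using WithBot.recBotCoe with
  | bot => rw [SpineTree.treeDegree_bot, Cardinal.mk_out]
  | coe p =>
    rw [SpineTree.treeDegree_coe, Cardinal.mk_out]
    refine cardPred_add_one ?_
    -- For κ = 0 the tree is the root alone, so there is no point `p` to consider.
    rintro rfl
    obtain ⟨a, -⟩ := SpinePoint.exists_first_le p
    exact (Cardinal.mk_ne_zero_iff.2 ⟨a⟩) (Cardinal.mk_out 0)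

/-! ### Finding spines in a branchwise-real tree -/

theorem IsChain.exists_orderIso_Iic_subset {X : Type v} [PartialOrder X] [IsBranchwiseRealTree X]
    (y : X) : ∃ C : Set X, IsChain (· ≤ ·) C ∧ Set.Iic y ⊆ C ∧
      ∃ I : Set ℝ, I.OrdConnected ∧ Nonempty (C ≃o I) := by
  obtain ⟨C, hC, hyC⟩ := (IsTreeOrder.isChain_Iic y).exists_maxChain
  exact ⟨C, hC.1, hyC, IsBranchwiseRealTree.branch_real C hC⟩

/-- Below every `y > x` there is an open spine directly above `x`. -/
theorem exists_spine_of_lt {X : Type v} [PartialOrder X] [IsBranchwiseRealTree X] {x y : X}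
    (hxy : x < y) :
    ∃ σ : Set.Ioi (0 : ℝ) → X, StrictMono σ ∧ (∀ t, x < σ t ∧ σ t ≤ y) ∧
      ∀ t z, x < z → z ≤ σ t → ∃ s ≤ t, z = σ s := by
  obtain ⟨C, -, hyC, I, hI, ⟨φ⟩⟩ := IsChain.exists_orderIso_Iic_subset y
  let x' : C := ⟨x, hyC hxy.le⟩
  let y' : C := ⟨y, hyC le_rfl⟩
  obtain ⟨a, ha⟩ : ∃ a, a = (φ x').1 := ⟨_, rfl⟩
  obtain ⟨b, hb⟩ : ∃ b, b = (φ y').1 := ⟨_, rfl⟩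
  have hab : a < b := by
    rw [ha, hb]
    exact Subtype.coe_lt_coe.2 (φ.strictMono (show x' < y' from hxy))
  -- An increasing bijection from (0, ∞) onto (a, b), with inverse sending c to (c - a) / (b - c).
  let g : ℝ → ℝ := fun t => b - (b - a) / (1 + t)
  have hg : ∀ t : Set.Ioi (0 : ℝ), a < g t ∧ g t < b := by
    intro t
    have ht : (0 : ℝ) < t.1 := t.2
    have h₁ : (b - a) / (1 + t.1) < b - a := div_lt_self (sub_pos.2 hab) (by linarith)
    have h₂ : 0 < (b - a) / (1 + t.1) := div_pos (sub_pos.2 hab) (by linarith)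
    simp only [g]
    constructor <;> linarith
  have hgmono : ∀ s t : Set.Ioi (0 : ℝ), s < t → g s < g t := by
    intro s t h
    have hs : (0 : ℝ) < s.1 := s.2
    have hst : s.1 < t.1 := h
    have : (b - a) / (1 + t.1) < (b - a) / (1 + s.1) :=
      div_lt_div_of_pos_left (sub_pos.2 hab) (by linarith) (by linarith)
    simp only [g]
    linarith
  have hgI : ∀ t : Set.Ioi (0 : ℝ), g t ∈ I := fun t =>
    hI.out (ha ▸ (φ x').2) (hb ▸ (φ y').2) ⟨(hg t).1.le, (hg t).2.le⟩
  have hφ : ∀ t, φ (φ.symm ⟨g t.1, hgI t⟩) = ⟨g t.1, hgI t⟩ := fun t => φ.apply_symm_apply _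
  have hmono : StrictMono fun t : Set.Ioi (0 : ℝ) => (φ.symm ⟨g t, hgI t⟩ : X) := fun s t h =>
    φ.symm.strictMono (show (⟨g s, hgI s⟩ : I) < ⟨g t, hgI t⟩ from hgmono s t h)
  have hlt : ∀ t : Set.Ioi (0 : ℝ), (φ.symm ⟨g t, hgI t⟩ : X) < y := by
    intro t
    have : φ.symm ⟨g t, hgI t⟩ < y' := by
      rw [← φ.lt_iff_lt, φ.apply_symm_apply, ← Subtype.coe_lt_coe, ← hb]
      exact (hg t).2
    exact this
  refine ⟨_, hmono, fun t => ⟨?_, (hlt t).le⟩, ?_⟩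
  · have : x' < φ.symm ⟨g t, hgI t⟩ := by
      rw [← φ.lt_iff_lt, φ.apply_symm_apply, ← Subtype.coe_lt_coe, ← ha]
      exact (hg t).1
    exact this
  · intro t z hxz hzt
    have hzy : z < y := hzt.trans_lt (hlt t)
    let z' : C := ⟨z, hyC hzy.le⟩
    obtain ⟨c, hc⟩ : ∃ c, c = (φ z').1 := ⟨_, rfl⟩
    have hac : a < c := by
      rw [ha, hc]
      exact Subtype.coe_lt_coe.2 (φ.strictMono (show x' < z' from hxz))
    have hcb : c < b := by
      rw [hc, hb]
      exact Subtype.coe_lt_coe.2 (φ.strictMono (show z' < y' from hzy))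
    have hpos : 0 < (c - a) / (b - c) := div_pos (sub_pos.2 hac) (sub_pos.2 hcb)
    obtain ⟨s, hs⟩ : ∃ s : Set.Ioi (0 : ℝ), s.1 = (c - a) / (b - c) :=
      ⟨⟨_, Set.mem_Ioi.2 hpos⟩, rfl⟩
    have hgs : g s = c := by
      have h₁ : b - c ≠ 0 := (sub_pos.2 hcb).ne'
      have h₂ : b - a ≠ 0 := (sub_pos.2 hab).ne'
      have h₃ : 1 + s.1 = (b - a) / (b - c) := by
        rw [hs]
        field_simp
        ring
      simp only [g]
      rw [h₃, div_div_cancel₀ h₂]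
      ring
    have hz : z = φ.symm ⟨g s, hgI s⟩ := by
      have : z' = φ.symm ⟨g s, hgI s⟩ := by
        rw [← φ.symm_apply_apply z']
        congr 1
        exact Subtype.ext (hc.symm.trans hgs.symm)
      exact congrArg Subtype.val this
    exact ⟨s, hmono.le_iff_le.1 (hz ▸ hzt), hz⟩

/-- An injective choice of components above `x` gives a family of spines above `x`. -/
theorem exists_isSpineFamily {X : Type v} [PartialOrder X] [IsBranchwiseRealTree X] {ι : Type u}
    {x : X} (j : ι ↪ Quotient (componentSetoid x)) :
    ∃ e : ι → Set.Ioi (0 : ℝ) → X, IsSpineFamily x e ∧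
      ∀ i t z (h : x < z), z ≤ e i t → Quotient.mk (componentSetoid x) ⟨z, h⟩ = j i := by
  have hj : ∀ i, ∃ σ : Set.Ioi (0 : ℝ) → X, (StrictMono σ ∧ (∀ t, x < σ t) ∧
      ∀ t z, x < z → z ≤ σ t → ∃ s ≤ t, z = σ s) ∧
      ∀ t z (h : x < z), z ≤ σ t → Quotient.mk (componentSetoid x) ⟨z, h⟩ = j i := by
    intro i
    obtain ⟨y, hy⟩ := Quotient.exists_rep (j i)
    obtain ⟨σ, hσ, hlt, hex⟩ := exists_spine_of_lt y.2
    refine ⟨σ, ⟨hσ, fun t => (hlt t).1, hex⟩, fun t z h hz => ?_⟩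
    rw [← hy]
    exact Quotient.sound ⟨z, h, le_rfl, hz.trans (hlt t).2⟩
  choose e he hcomp using hj
  refine ⟨e, ⟨fun i => (he i).1, fun i => (he i).2.1, fun i => (he i).2.2, ?_⟩, hcomp⟩
  intro i i' s t z hz h h'
  exact j.injective ((hcomp i s z hz h).symm.trans (hcomp i' t z hz h'))

theorem IsUniformlyBranching.nonempty_embedding {κ : Cardinal.{u}} {X : Type v} [PartialOrder X]
    [IsTreeOrder X] (hX : IsUniformlyBranching κ X) {r : Cardinal.{u}} (hr : r ≤ κ) (x : X) :
    Nonempty (r.out ↪ Quotient (componentSetoid x)) := by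
  rw [← Cardinal.lift_mk_le', Cardinal.mk_out]
  refine (Cardinal.lift_le.2 hr).trans ?_
  rw [← hX x]
  exact le_rfl

/-- Adding `c` back to the other components gives κ of them, and 1 can be cancelled in cardinal
addition. -/
theorem IsUniformlyBranching.nonempty_embedding_ne {κ : Cardinal.{u}} {X : Type v}
    [PartialOrder X] [IsTreeOrder X] (hX : IsUniformlyBranching κ X) (x : X)
    (c : Quotient (componentSetoid x)) :
    Nonempty ((cardPred κ).out ↪ {d : Quotient (componentSetoid x) // d ≠ c}) := by
  classical
  rw [← Cardinal.lift_mk_le', Cardinal.mk_out]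
  refine lift_cardPred_le ?_
  rw [← hX x, treeDegree, ← Cardinal.mk_congr (Equiv.optionSubtypeNe c), Cardinal.mk_option,
    Cardinal.lift_add, Cardinal.lift_one]

/-- The data used to grow a copy of `SpineTree A B` in `X`: spines above a base point and, for
all `x < y`, spines above `x` in components not containing `y`. -/
structure SpineSystem (A B : Type u) (X : Type v) [PartialOrder X] where
  root : X
  rootSpine : A → Set.Ioi (0 : ℝ) → X
  isSpineFamily_rootSpine : IsSpineFamily root rootSpine
  spine : {p : X × X // p.1 < p.2} → B → Set.Ioi (0 : ℝ) → X
  isSpineFamily_spine : ∀ p, IsSpineFamily p.1.1 (spine p)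
  not_le : ∀ p b t z, p.1.1 < z → z ≤ spine p b t → ¬ z ≤ p.1.2

theorem IsUniformlyBranching.nonempty_spineSystem {κ r : Cardinal.{u}} {X : Type v}
    [PartialOrder X] [IsBranchwiseRealTree X] (hX : IsUniformlyBranching κ X) (hr : r ≤ κ) :
    Nonempty (SpineSystem r.out (cardPred κ).out X) := by
  obtain ⟨x₀, -⟩ := IsTreeOrder.exists_root (X := X)
  obtain ⟨j⟩ := hX.nonempty_embedding hr x₀
  obtain ⟨e₀, he₀, -⟩ := exists_isSpineFamily j
  have h : ∀ p : {p : X × X // p.1 < p.2}, ∃ e : (cardPred κ).out → Set.Ioi (0 : ℝ) → X,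
      IsSpineFamily p.1.1 e ∧ ∀ b t z, p.1.1 < z → z ≤ e b t → ¬ z ≤ p.1.2 := by
    intro p
    obtain ⟨k⟩ := hX.nonempty_embedding_ne p.1.1 (Quotient.mk _ ⟨p.1.2, p.2⟩)
    obtain ⟨e, he, hk⟩ := exists_isSpineFamily (k.trans (Function.Embedding.subtype _))
    refine ⟨e, he, fun b t z hz h hzy => (k b).2 ?_⟩
    -- A point `z` above the base and below both the spine and the reference point would put the
    -- spine in the component that `k` avoids.
    exact (hk b t z hz h).symm.trans (Quotient.sound ⟨z, hz, le_rfl, hzy⟩)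
  choose e he hne using h
  exact ⟨⟨x₀, e₀, he₀, e, he, hne⟩⟩

/-! ### Growing a copy of the tree: order embedding and continuity -/

namespace SpineSystem

open SpinePoint

variable {A B : Type u} {X : Type v} [PartialOrder X] (S : SpineSystem A B X)

/-- The height `t + 1`. -/
def _root_.SpinePoint.succHeight (t : Set.Ioi (0 : ℝ)) : Set.Ioi (0 : ℝ) :=
  ⟨t.1 + 1, Set.mem_Ioi.2 (add_pos (Set.mem_Ioi.1 t.2) one_pos)⟩

theorem _root_.SpinePoint.lt_succHeight (t : Set.Ioi (0 : ℝ)) : t < succHeight t :=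
  Subtype.coe_lt_coe.1 (lt_add_one t.1)

/-- The image of a point together with the image of a later point on the same spine. -/
def growPair : SpinePoint A B → {p : X × X // p.1 < p.2}
  | first a t => ⟨(S.rootSpine a t, S.rootSpine a (succHeight t)),
      S.isSpineFamily_rootSpine.strictMono a (lt_succHeight t)⟩
  | next p b t => ⟨(S.spine (growPair p) b t, S.spine (growPair p) b (succHeight t)),
      (S.isSpineFamily_spine (growPair p)).strictMono b (lt_succHeight t)⟩

/-- The image of a point of the tree grown by the system `S`. -/
def growPoint (x : SpinePoint A B) : X := (S.growPair x).1.1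

/-- The map from `SpineTree A B` to the tree grown by the system `S`. -/
def grow : SpineTree A B → X := fun x => x.recBotCoe S.root S.growPoint

theorem growPoint_lt_next (p : SpinePoint A B) (b : B) (t : Set.Ioi (0 : ℝ)) :
    S.growPoint p < S.growPoint (next p b t) := (S.isSpineFamily_spine _).lt b t

theorem root_lt_growPoint (x : SpinePoint A B) : S.root < S.growPoint x := by
  induction x with
  | first a t => exact S.isSpineFamily_rootSpine.lt a t
  | next p b t ih => exact ih.trans (S.growPoint_lt_next p b t)

theorem growPoint_mono : Monotone S.growPoint := by
  intro x y h
  induction y with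
  | first a t =>
    obtain ⟨s, hs, rfl⟩ := h
    exact (S.isSpineFamily_rootSpine.strictMono a).monotone hs
  | next p b t ih =>
    rcases h with h | ⟨s, hs, rfl⟩
    · exact (ih h).trans (S.growPoint_lt_next p b t).le
    · exact ((S.isSpineFamily_spine _).strictMono b).monotone hs

theorem growPoint_lt_rise (p : SpinePoint A B) (t : Set.Ioi (0 : ℝ)) :
    S.growPoint p < S.growPoint (rise p t) := by
  cases p with
  | first a s =>
    exact S.isSpineFamily_rootSpine.strictMono a
      (Subtype.coe_lt_coe.1 (lt_add_of_pos_right s.1 t.2))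
  | next q b s =>
    exact (S.isSpineFamily_spine _).strictMono b
      (Subtype.coe_lt_coe.1 (lt_add_of_pos_right s.1 t.2))

theorem growPoint_strictMono : StrictMono S.growPoint := by
  intro x y h
  obtain ⟨t, h | ⟨b, h⟩⟩ := exists_rise_or_next_le h
  · exact (S.growPoint_lt_rise x t).trans_le (S.growPoint_mono h)
  · exact (S.growPoint_lt_next x b t).trans_le (S.growPoint_mono h)

theorem grow_strictMono : StrictMono S.grow := by
  intro x y h
  induction y using WithBot.recBotCoe with
  | bot => exact absurd h not_lt_bot
  | coe y =>
    induction x using WithBot.recBotCoe with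
    | bot => exact S.root_lt_growPoint y
    | coe x => exact S.growPoint_strictMono (WithBot.coe_lt_coe.1 h)

/-- The image of `S.grow` is closed downwards above the base point. -/
theorem exists_grow_eq [IsTreeOrder X] {z : X} {y : SpineTree A B} (hz : S.root ≤ z)
    (h : z ≤ S.grow y) : ∃ w, w ≤ y ∧ S.grow w = z := by
  rcases hz.eq_or_lt with rfl | hz
  · exact ⟨⊥, bot_le, rfl⟩
  induction y using WithBot.recBotCoe with
  | bot => exact absurd h hz.not_ge
  | coe y =>
    suffices ∃ w, w ≤ y ∧ S.growPoint w = z from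
      let ⟨w, hw, e⟩ := this
      ⟨w, WithBot.coe_le_coe.2 hw, e⟩
    change z ≤ S.growPoint y at h
    induction y with
    | first a t =>
      obtain ⟨s, hs, rfl⟩ := S.isSpineFamily_rootSpine.exists_eq a t z hz h
      exact ⟨first a s, ⟨s, hs, rfl⟩, rfl⟩
    | next p b t ih =>
      by_cases hp : z ≤ S.growPoint p
      · obtain ⟨w, hw, e⟩ := ih hp
        exact ⟨w, Or.inl hw, e⟩
      -- Both `z` and the image of `p` lie below the image of `next p b t`, hence are comparable; so
      -- `z` lies on the last spine.
      · have hp : S.growPoint p < z :=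
          lt_of_le_not_ge (((IsTreeOrder.isChain_Iic _).total h
            (S.growPoint_lt_next p b t).le).resolve_left hp) hp
        obtain ⟨s, hs, rfl⟩ := (S.isSpineFamily_spine _).exists_eq b t z hp h
        exact ⟨next p b s, Or.inr ⟨s, hs, rfl⟩, rfl⟩

/-- The image of the continuation of a spine meets the component of the reference point. -/
theorem exists_le_of_le_growPoint_rise [IsTreeOrder X] {p : SpinePoint A B}
    {t : Set.Ioi (0 : ℝ)} {z : X} (hz : S.growPoint p < z) (h : z ≤ S.growPoint (rise p t)) :
    ∃ w, S.growPoint p < w ∧ w ≤ z ∧ w ≤ (S.growPair p).1.2 := by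
  -- The reference point is one unit further along the spine of `p`, so rising by min(1, t) stays
  -- below both it and the image of `rise p t`.
  obtain ⟨w, hw, hw₁, hw₂⟩ : ∃ w, S.growPoint p < w ∧ w ≤ S.growPoint (rise p t) ∧
      w ≤ (S.growPair p).1.2 := by
    let s : Set.Ioi (0 : ℝ) := min ⟨1, Set.mem_Ioi.2 one_pos⟩ t
    refine ⟨S.growPoint (rise p s), S.growPoint_lt_rise p s,
      S.growPoint_mono (rise_le_rise (min_le_right _ _)), ?_⟩
    have hs : s.1 ≤ 1 := (min_le_left _ _ : s ≤ ⟨1, Set.mem_Ioi.2 one_pos⟩)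
    cases p with
    | first a r =>
      exact (S.isSpineFamily_rootSpine.strictMono a).monotone
        (Subtype.coe_le_coe.1 (add_le_add_right hs r.1))
    | next q b r =>
      exact ((S.isSpineFamily_spine _).strictMono b).monotone
        (Subtype.coe_le_coe.1 (add_le_add_right hs r.1))
  rcases (IsTreeOrder.isChain_Iic _).total h hw₁ with h' | h'
  · exact ⟨z, hz, le_rfl, h'.trans hw₂⟩
  · exact ⟨w, hw, h', hw₂⟩

/-- Two new spines are separated because they form a spine family. The continuation is separated
from a new spine because it starts in the component of the reference point, which new spines avoid.
-/
theorem eq_of_le_grow_pointSpine [IsTreeOrder X] {p : SpinePoint A B} {i j : Option B}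
    {s t : Set.Ioi (0 : ℝ)} {z : X} (hz : S.growPoint p < z)
    (hi : z ≤ S.grow (SpineTree.pointSpine p i s)) (hj : z ≤ S.grow (SpineTree.pointSpine p j t)) :
    i = j := by
  have key : ∀ {b s t}, z ≤ S.growPoint (rise p s) → ¬ z ≤ S.growPoint (next p b t) := by
    intro b s t h h'
    obtain ⟨w, hw, hwz, hw'⟩ := S.exists_le_of_le_growPoint_rise hz h
    exact S.not_le _ b t w hw (hwz.trans h') hw'
  cases i with
  | none =>
    cases j with
    | none => rfl
    | some c => exact absurd hj (key hi)
  | some b =>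
    cases j with
    | none => exact absurd hi (key hj)
    | some c => exact congrArg some ((S.isSpineFamily_spine _).eq_of_le b c s t z hz hi hj)

/-- A strictly monotone map that separates the spines above a meet reflects the order. -/
theorem _root_.le_of_map_le_of_isGreatest {Y : Type u} [PartialOrder Y] [IsTreeOrder X]
    {f : Y → X} (hf : StrictMono f) {x y m : Y} (hm : IsGreatest {z | z ≤ x ∧ z ≤ y} m)
    {ι : Type u} {e : ι → Set.Ioi (0 : ℝ) → Y} (he : IsSpineFamily m e)
    (hcover : ∀ z, m < z → ∃ i t, e i t ≤ z)
    (hsep : ∀ i j s t z, f m < z → z ≤ f (e i s) → z ≤ f (e j t) → i = j)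
    (h : f x ≤ f y) : x ≤ y := by
  rcases hm.1.1.eq_or_lt with rfl | hx
  · exact hm.1.2
  rcases hm.1.2.eq_or_lt with rfl | hy
  · exact absurd h (hf hx).not_ge
  obtain ⟨i, s, hi⟩ := hcover x hx
  obtain ⟨j, t, hj⟩ := hcover y hy
  -- The images of the two spine points both lie below `f y`; the lower of them lies below both, and
  -- separation applies to it.
  have hij : i = j := by
    rcases (IsTreeOrder.isChain_Iic (f y)).total ((hf.monotone hi).trans h) (hf.monotone hj)
      with hle | hle
    · exact hsep i j s t _ (hf (he.lt i s)) le_rfl hle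
    · exact hsep i j s t _ (hf (he.lt j t)) hle le_rfl
  subst hij
  -- If `x` and `y` lay above the same spine over the meet, the lower of its two points would be a
  -- common lower bound strictly above the meet.
  have := hm.2 ⟨((he.strictMono i).monotone (min_le_left s t)).trans hi,
    ((he.strictMono i).monotone (min_le_right s t)).trans hj⟩
  exact absurd this (he.lt i _).not_ge

theorem le_of_grow_le_grow [IsTreeOrder X] {x y : SpineTree A B} (h : S.grow x ≤ S.grow y) :
    x ≤ y := by
  obtain ⟨m, hm⟩ := SpineTree.exists_meet x y
  induction m using WithBot.recBotCoe with
  | bot =>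
    exact le_of_map_le_of_isGreatest S.grow_strictMono hm SpineTree.isSpineFamily_rootSpine
      (fun _ => SpineTree.exists_rootSpine_le)
      (fun i j s t z hz hi hj => S.isSpineFamily_rootSpine.eq_of_le i j s t z hz hi hj) h
  | coe p =>
    exact le_of_map_le_of_isGreatest S.grow_strictMono hm (SpineTree.isSpineFamily_pointSpine p)
      (fun _ => SpineTree.exists_pointSpine_le)
      (fun i j s t z hz hi hj => S.eq_of_le_grow_pointSpine hz hi hj) h

/-- `SpineSystem.grow` as an order embedding. -/
def growEmbedding [IsTreeOrder X] : SpineTree A B ↪o X :=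
  OrderEmbedding.ofMapLEIff S.grow
    fun _ _ => ⟨S.le_of_grow_le_grow, fun h => S.grow_strictMono.monotone h⟩

theorem surjOn_growEmbedding [IsTreeOrder X] (x y : SpineTree A B) :
    Set.SurjOn S.growEmbedding (Set.Icc x y)
      (Set.Icc (S.growEmbedding x) (S.growEmbedding y)) := by
  rintro z ⟨hxz, hzy⟩
  obtain ⟨w, hw, rfl⟩ := S.exists_grow_eq
    ((S.grow_strictMono.monotone (bot_le : ⊥ ≤ x)).trans hxz) hzy
  exact ⟨w, ⟨S.le_of_grow_le_grow hxz, hw⟩, rfl⟩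

end SpineSystem

/-! ### Automorphisms and homogeneity -/

namespace SpinePoint

variable {A B : Type u}

/-- Apply permutations to the spines above the root and to their heights. -/
def relabel (π : Equiv.Perm A) (τ : Set.Ioi (0 : ℝ) ≃o Set.Ioi (0 : ℝ)) :
    SpinePoint A B → SpinePoint A B
  | first a t => first (π a) (τ t)
  | next p b t => next (relabel π τ p) b t

theorem relabel_mono (π : Equiv.Perm A) (τ : Set.Ioi (0 : ℝ) ≃o Set.Ioi (0 : ℝ)) :
    Monotone (relabel π τ : SpinePoint A B → SpinePoint A B) := by
  intro x y h
  induction y with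
  | first a t =>
    obtain ⟨s, hs, rfl⟩ := h
    exact ⟨_, τ.monotone hs, rfl⟩
  | next p b t ih =>
    rcases h with h | ⟨s, hs, rfl⟩
    · exact Or.inl (ih h)
    · exact Or.inr ⟨s, hs, rfl⟩

theorem relabel_symm_relabel (π : Equiv.Perm A) (τ : Set.Ioi (0 : ℝ) ≃o Set.Ioi (0 : ℝ))
    (x : SpinePoint A B) : relabel π.symm τ.symm (relabel π τ x) = x := by
  induction x with
  | first a t => simp [relabel]
  | next p b t ih => simp [relabel, ih]

/-- `SpinePoint.relabel` as an automorphism. -/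
def relabelIso (π : Equiv.Perm A) (τ : Set.Ioi (0 : ℝ) ≃o Set.Ioi (0 : ℝ)) :
    SpinePoint A B ≃o SpinePoint A B :=
  Equiv.toOrderIso
    ⟨relabel π τ, relabel π.symm τ.symm, relabel_symm_relabel π τ,
      fun x => by simpa using relabel_symm_relabel π.symm τ.symm x⟩
    (relabel_mono _ _) (relabel_mono _ _)

/-- Multiplication by t / s. -/
theorem exists_orderIso_Ioi (s t : Set.Ioi (0 : ℝ)) :
    ∃ τ : Set.Ioi (0 : ℝ) ≃o Set.Ioi (0 : ℝ), τ s = t := by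
  have hs : (0 : ℝ) < s.1 := s.2
  have ht : (0 : ℝ) < t.1 := t.2
  refine ⟨Equiv.toOrderIso
    ⟨fun x => ⟨x.1 * (t.1 / s.1), mul_pos (Set.mem_Ioi.1 x.2) (div_pos ht hs)⟩,
      fun x => ⟨x.1 * (s.1 / t.1), mul_pos (Set.mem_Ioi.1 x.2) (div_pos hs ht)⟩, ?_, ?_⟩ ?_ ?_, ?_⟩
  · intro x
    refine Subtype.ext ?_
    change x.1 * _ * _ = x.1
    field_simp
  · intro x
    refine Subtype.ext ?_
    change x.1 * _ * _ = x.1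
    field_simp
  · intro x y h
    exact Subtype.coe_le_coe.1 (mul_le_mul_of_nonneg_right h (div_pos ht hs).le)
  · intro x y h
    exact Subtype.coe_le_coe.1 (mul_le_mul_of_nonneg_right h (div_pos hs ht).le)
  · refine Subtype.ext ?_
    change s.1 * _ = t.1
    field_simp

open Classical in
/-- Exchange the spine `b` above `p` with the continuation of the spine of `p`. -/
noncomputable def swap (p : SpinePoint A B) (b : B) : SpinePoint A B → SpinePoint A B
  | first a t => if h : ∃ s, first a t = rise p s then next p b h.choose else first a t
  | next q c t =>
    if h : ∃ s, next q c t = rise p s then next p b h.choose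
    else if q = p ∧ c = b then rise p t else next (swap p b q) c t

variable (p : SpinePoint A B) (b : B)

theorem next_ne_rise (c : B) (s t : Set.Ioi (0 : ℝ)) : next p c s ≠ rise p t := by
  intro h
  have := congrArg stage h
  simp [stage] at this

theorem swap_rise (s : Set.Ioi (0 : ℝ)) : swap p b (rise p s) = next p b s := by
  have key : ∀ x (h : ∃ s, x = rise p s), swap p b x = next p b h.choose := by
    intro x h
    cases x with
    | first a t => simp only [swap, dif_pos h]
    | next q c t => simp only [swap, dif_pos h]
  have h : ∃ s', rise p s = rise p s' := ⟨s, rfl⟩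
  rw [key _ h, ← rise_injective p h.choose_spec]

theorem swap_next_self (t : Set.Ioi (0 : ℝ)) : swap p b (next p b t) = rise p t := by
  have h : ¬ ∃ s, next p b t = rise p s := fun ⟨s, h⟩ => next_ne_rise p b t s h
  simp [swap, dif_neg h]

variable {p b}

theorem swap_first {a : A} {t : Set.Ioi (0 : ℝ)} (h : ∀ s, first a t ≠ rise p s) :
    swap p b (first a t) = first a t := by
  have h : ¬ ∃ s, first a t = rise p s := fun ⟨s, h'⟩ => h s h'
  simp only [swap, dif_neg h]

theorem swap_next {q : SpinePoint A B} {c : B} {t : Set.Ioi (0 : ℝ)}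
    (h : ∀ s, next q c t ≠ rise p s) (h' : ¬ (q = p ∧ c = b)) :
    swap p b (next q c t) = next (swap p b q) c t := by
  have h : ¬ ∃ s, next q c t = rise p s := fun ⟨s, h'⟩ => h s h'
  simp only [swap, dif_neg h, if_neg h']

theorem swap_of_le {x : SpinePoint A B} (h : x ≤ p) : swap p b x = x := by
  have hr : ∀ s, x ≠ rise p s := by
    rintro s rfl
    exact (lt_rise p s).not_ge h
  induction x with
  | first a t => exact swap_first hr
  | next q c t ih =>
    have hq : q < p := (lt_next q c t).trans_le h
    rw [swap_next hr (fun hqc => hq.ne hqc.1), ih hq.le]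
    rintro s rfl
    exact (lt_rise p s).not_gt hq

/-- The four cases are those in which `swap` is computed by `swap_rise`, `swap_next_self`,
`swap_first` and `swap_next`. -/
theorem swap_induction {P : SpinePoint A B → Prop} (p : SpinePoint A B) (b : B)
    (hrise : ∀ s, P (rise p s)) (hnext_self : ∀ s, P (next p b s))
    (hfirst : ∀ a t, (∀ s, first a t ≠ rise p s) → P (first a t))
    (hnext : ∀ q c t, (∀ s, next q c t ≠ rise p s) → ¬ (q = p ∧ c = b) → P q → P (next q c t))
    (x : SpinePoint A B) : P x := by
  have key : ∀ y, (∀ s, y ≠ rise p s) ∨ ∃ s, y = rise p s := fun y => by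
    by_cases h : ∃ s, y = rise p s
    · exact Or.inr h
    · exact Or.inl fun s hs => h ⟨s, hs⟩
  induction x with
  | first a t =>
    rcases key (first a t) with h | ⟨s, h⟩
    · exact hfirst a t h
    · exact h ▸ hrise s
  | next q c t ih =>
    rcases key (next q c t) with h | ⟨s, h⟩
    · by_cases hq : q = p ∧ c = b
      · obtain ⟨rfl, rfl⟩ := hq
        exact hnext_self t
      · exact hnext q c t h hq ih
    · exact h ▸ hrise s

theorem swap_swap (p : SpinePoint A B) (b : B) (x : SpinePoint A B) :
    swap p b (swap p b x) = x := by
  induction x using swap_induction p b with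
  | hrise s => rw [swap_rise, swap_next_self]
  | hnext_self s => rw [swap_next_self, swap_rise]
  | hfirst a t h => rw [swap_first h, swap_first h]
  | hnext q c t h hq ih =>
    -- The image of `next q c t` must not lie on either exchanged spine. If it did, `swap p b q`
    -- would be `p` or the base of the spine of `p`; these are fixed by the swap, so `q` itself
    -- would be that point, contrary to the case assumptions.
    have key : ∀ {q'}, q' ≤ p → swap p b q = q' → q = q' := by
      intro q' hq' e
      rw [← ih, e, swap_of_le hq']
    rw [swap_next h hq, swap_next ?_ ?_, ih]
    · intro s e
      cases p with
      | first a r => cases e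
      | next q' c' r =>
        injection e with e₁ e₂ e₃
        obtain rfl := key (lt_next q' c' r).le e₁
        subst e₂ e₃
        exact h s rfl
    · rintro ⟨e, rfl⟩
      exact hq ⟨key le_rfl e, rfl⟩

theorem swap_mono (p : SpinePoint A B) (b : B) : Monotone (swap p b) := by
  intro x y hxy
  induction y using swap_induction p b with
  | hrise s =>
    rw [swap_rise]
    rcases le_rise_iff.1 hxy with h | ⟨s', hs, rfl⟩
    · exact Or.inl ((swap_of_le h).le.trans h)
    · rw [swap_rise]
      exact next_le_next_left _ _ hs
  | hnext_self s =>
    rw [swap_next_self]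
    rcases le_next_iff.1 hxy with h | ⟨s', hs, rfl⟩
    · exact le_rise_iff.2 (Or.inl ((swap_of_le h).le.trans h))
    · rw [swap_next_self]
      exact rise_le_rise hs
  | hfirst a t h =>
    obtain ⟨s, hs, rfl⟩ := hxy
    rw [swap_first h, swap_first]
    · exact ⟨s, hs, rfl⟩
    -- The continuation of the spine of `p` is closed upwards within that spine: if the lower point
    -- were on it, so would be the point at height `t`. The same argument handles `next` below.
    · intro r e
      cases p with
      | first a' r' =>
        injection e with e₁ e₂
        subst e₁ e₂
        have hs' : r'.1 + r.1 ≤ t.1 := hs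
        have hr : (0 : ℝ) < r.1 := r.2
        refine h ⟨t.1 - r'.1, Set.mem_Ioi.2 (by linarith)⟩ ?_
        simp [rise]
      | next q c r' => cases e
  | hnext q c t h hq ih =>
    rw [swap_next h hq]
    rcases le_next_iff.1 hxy with hx | ⟨s, hs, rfl⟩
    · exact Or.inl (ih hx)
    · rw [swap_next ?_ hq]
      · exact next_le_next_left _ _ hs
      · intro r e
        cases p with
        | first a' r' => cases e
        | next q' c' r' =>
          injection e with e₁ e₂ e₃
          subst e₁ e₂ e₃
          have hs' : r'.1 + r.1 ≤ t.1 := hs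
          have hr : (0 : ℝ) < r.1 := r.2
          refine h ⟨t.1 - r'.1, Set.mem_Ioi.2 (by linarith)⟩ ?_
          simp [rise]

/-- `SpinePoint.swap` as an automorphism. -/
noncomputable def swapIso (p : SpinePoint A B) (b : B) : SpinePoint A B ≃o SpinePoint A B :=
  Equiv.toOrderIso ⟨swap p b, swap p b, swap_swap p b, swap_swap p b⟩ (swap_mono p b)
    (swap_mono p b)

/-- Induction on the stage: the swap at `p` and `b` takes `next p b t` to `rise p t`, whose stage is
that of `p`. Structural induction would not do, since `rise p t` is not a subterm. -/
theorem exists_orderIso_eq_first (x : SpinePoint A B) :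
    ∃ (f : SpinePoint A B ≃o SpinePoint A B) (a : A) (t : Set.Ioi (0 : ℝ)), f x = first a t := by
  obtain ⟨n, hn⟩ : ∃ n, x.stage = n := ⟨_, rfl⟩
  induction n generalizing x with
  | zero => cases x <;> simp [stage] at hn
  | succ n ih =>
    cases x with
    | first a t => exact ⟨OrderIso.refl _, a, t, rfl⟩
    | next p b t =>
      obtain ⟨f, a, s, h⟩ := ih (rise p t) (by simpa [stage] using hn)
      refine ⟨(swapIso p b).trans f, a, s, ?_⟩
      rw [← h, ← swap_next_self p b t]
      rfl

theorem exists_orderIso_eq (x y : SpinePoint A B) :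
    ∃ f : SpinePoint A B ≃o SpinePoint A B, f x = y := by
  obtain ⟨f, a, s, hf⟩ := exists_orderIso_eq_first x
  obtain ⟨g, a', t, hg⟩ := exists_orderIso_eq_first y
  obtain ⟨τ, hτ⟩ := exists_orderIso_Ioi s t
  classical
  refine ⟨(f.trans (relabelIso (Equiv.swap a a') τ)).trans g.symm, ?_⟩
  have h : relabelIso (Equiv.swap a a') τ (first a s : SpinePoint A B) = first a' t := by
    simp [relabelIso, relabel, hτ]
  simp only [OrderIso.trans_apply, hf, h, ← hg, OrderIso.symm_apply_apply]

end SpinePoint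

theorem SpineTree.exists_orderIso_eq {A B : Type u} {x y : SpineTree A B} (hx : x ≠ ⊥)
    (hy : y ≠ ⊥) : ∃ f : SpineTree A B ≃o SpineTree A B, f x = y := by
  obtain ⟨x, rfl⟩ := WithBot.ne_bot_iff_exists.1 hx
  obtain ⟨y, rfl⟩ := WithBot.ne_bot_iff_exists.1 hy
  obtain ⟨f, rfl⟩ := SpinePoint.exists_orderIso_eq x y
  exact ⟨f.withBotCongr, rfl⟩

theorem mainTheorem5 (κ r : Cardinal.{u}) (hr : r = κ ∨ r = cardPred κ) :
    IsBranchwiseRealTree (MinimalTree κ r) ∧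
    (r = κ → IsUniformlyBranching κ (MinimalTree κ r)) ∧
    (∀ (X : Type v) [PartialOrder X] [IsBranchwiseRealTree X], IsUniformlyBranching κ X →
      ∃ f : MinimalTree κ r ↪o X, ∀ x y : MinimalTree κ r, x < y →
        Set.SurjOn f (Set.Icc x y) (Set.Icc (f x) (f y))) ∧
    (∀ x y : MinimalTree κ r, x ≠ ⊥ → y ≠ ⊥ →
      ∃ f : MinimalTree κ r ≃o MinimalTree κ r, f x = y) := by
  refine ⟨inferInstance, ?_, ?_, fun x y => SpineTree.exists_orderIso_eq⟩
  · rintro rfl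
    exact isUniformlyBranching_minimalTree r
  · intro X _ _ hX
    have hrκ : r ≤ κ := by
      rcases hr with rfl | rfl
      · exact le_rfl
      · exact cardPred_le κ
    obtain ⟨S⟩ := hX.nonempty_spineSystem hrκ
    exact ⟨S.growEmbedding, fun x y _ => S.surjOn_growEmbedding x y⟩
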